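/- Let $S$ be a countable set, let $p:S\times S\to[0,\infty)$ satisfy $p(i,l)=p(l,i)$ and $\sum_{l\in S}p(i,l)=1$ for all $i$, let $2j\in\mathbb N$, let $\partial S\subset S$ and let $0<\rho_i<1$ for $i\in\partial S$. Let $\partial_eS=\{i_e: i\in\partial S\}$ be a disjoint copy of $\partial S$ (the sink sites), and write $\rho_{i_e}=\rho_i$. The boundary driven $2j$-SEP is the process $(\eta_t)_{t\ge0}$ on $\{0,1,\dots,2j\}^S$ with generator, on functions $f$ that depend on finitely many coordinates, $$\mathcal L_jf(\eta)=\sum_{i,l\in S}p(i,l)\,\eta_i(2j-\eta_l)\bigl(f(\eta^{i,l})-f(\eta)\bigr)+\sum_{i\in\partial S}\Bigl[(1-\rho_i)\,\eta_i\bigl(f(\eta^{i,-})-f(\eta)\bigr)+\rho_i(2j-\eta_i)\bigl(f(\eta^{i,+})-f(\eta)\bigr)\Bigr],$$ where $\eta^{i,l}$ arises from $\eta$ by moving a particle from $i$ to $l$, and $\eta^{i,-}$, $\eta^{i,+}$ by removing, respectively adding, a particle at $i$. The $2j$-SEP with absorbing sink sites is the process $(\xi_t)_{t\ge0}$ on the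 countable set $\Omega_{dual}$ of maps $\xi:S\cup\partial_eS\to\mathbb N$ with $\xi_i\le 2j$ for $i\in S$ and with finitely many particles in total, with generator, on bounded functions $f$, $$\mathcal L_j^{dual}f(\xi)=\sum_{i,l\in S}p(i,l)\,\xi_i(2j-\xi_l)\bigl(f(\xi^{i,l})-f(\xi)\bigr)+\sum_{i\in\partial S}\xi_i\bigl(f(\xi^{i,i_e})-f(\xi)\bigr).$$ Here a process with a given generator is a family of laws, one for each starting point, of a process with càdlàg paths that solves the martingale problem for the generator on the indicated functions. Theorem. $(\eta_t)_{t\ge 0}$ is dual to $(\xi_t)_{t\ge 0}$ with duality function $$D(\eta,\xi)=\prod_{i\in\partial_eS}\rho_i^{\xi_i}\ \prod_{i\in S}\frac{\binom{\eta_i}{\xi_i}}{\binom{2j}{\xi_i}},$$ that is, $\mathbb E_\eta D(\eta_t,\xi)=\mathbb E_\xi D(\eta,\xi_t)$ for all $t\ge0$, $\eta\in\{0,\dots,2j\}^S$ and $\xi\in\Omega_{dual}$. -/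

import Mathlib

open MeasureTheory Filter Topology
open scoped NNReal

noncomputable section

namespace BoundarySEP

/-! ## Markov processes specified by a generator, and duality -/

/-- `Z` is a process with càdlàg paths in `E` and `P x` is the law under which it starts from `x`;
under every `P x` it solves the martingale problem for the operator `L` on the class `dom` of test
functions: `f (Z t) - f (Z 0) - ∫₀ᵗ L f (Z s) ds` is a martingale for every `f ∈ dom`. -/
structure IsProcessWithGenerator {E X : Type*} [TopologicalSpace E] [MeasurableSpace E]
    {m : MeasurableSpace X} (dom : Set (E → ℝ)) (L : (E → ℝ) → E → ℝ)
    (𝓕 : Filtration ℝ≥0 m) (P : E → Measure X) (Z : ℝ≥0 → X → E) : Prop where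
  isProbabilityMeasure : ∀ x, IsProbabilityMeasure (P x)
  adapted : ∀ t, Measurable[𝓕 t] (Z t)
  right_continuous : ∀ ω t, ContinuousWithinAt (fun s => Z s ω) (Set.Ici t) t
  left_limits : ∀ ω t, ∃ z, Tendsto (fun s => Z s ω) (𝓝[<] t) (𝓝 z)
  initial : ∀ x, ∀ᵐ ω ∂(P x), Z 0 ω = x
  martingale : ∀ x, ∀ f ∈ dom,
    Martingale (fun (t : ℝ≥0) ω =>
      f (Z t ω) - f (Z 0 ω) - ∫ s in (0 : ℝ)..(t : ℝ), L f (Z s.toNNReal ω)) 𝓕 (P x)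

/-- The process `(W, Q)` is dual to the process `(Z, P)` with duality function `D`:
`𝔼_x D(Z_t, y) = 𝔼_y D(x, W_t)` for all times `t` and all starting points `x`, `y`. -/
def IsDualWith {E F X Y : Type*} [MeasurableSpace X] [MeasurableSpace Y]
    (P : E → Measure X) (Z : ℝ≥0 → X → E) (Q : F → Measure Y) (W : ℝ≥0 → Y → F)
    (D : E → F → ℝ) : Prop :=
  ∀ (t : ℝ≥0) (x : E) (y : F), ∫ ω, D (Z t ω) y ∂(P x) = ∫ ω, D x (W t ω) ∂(Q y)

/-- A symmetric random walk kernel on `S`. -/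
structure IsSymmetricKernel {S : Type*} (p : S → S → ℝ) : Prop where
  nonneg : ∀ i l, 0 ≤ p i l
  symm : ∀ i l, p i l = p l i
  hasSum_one : ∀ i, HasSum (p i) 1

/-! ## The boundary driven `2j`-SEP; throughout `N = 2j` -/

section Primal

variable {S : Type*} {N : ℕ}

/-- Configurations `{0, …, N}^S`, with the product topology and product `σ`-algebra. -/
abbrev Config (S : Type*) (N : ℕ) : Type _ := S → Fin (N + 1)

open Classical in
/-- Add a particle at `i` (no effect if `i` already holds `N` particles). -/
def Config.add (η : Config S N) (i : S) : Config S N :=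
  Function.update η i ⟨min ((η i : ℕ) + 1) N, by omega⟩

open Classical in
/-- Remove a particle at `i` (no effect if `i` is empty). -/
def Config.remove (η : Config S N) (i : S) : Config S N :=
  Function.update η i ⟨(η i : ℕ) - 1, by omega⟩

/-- Local functions: those that depend on finitely many coordinates. -/
def localFunctions (S : Type*) (N : ℕ) : Set (Config S N → ℝ) :=
  {f | ∃ A : Finset S, ∀ η η' : Config S N, (∀ i ∈ A, η i = η' i) → f η = f η'}

/-- The generator of the boundary driven `N`-SEP with boundary `B` and reservoir densities `ρ`.
For a local function both series converge absolutely. -/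
def generator (p : S → S → ℝ) (B : Set S) (ρ : B → ℝ) (f : Config S N → ℝ) (η : Config S N) : ℝ :=
  (∑' q : S × S, p q.1 q.2 * (η q.1 : ℝ) * ((N : ℝ) - (η q.2 : ℝ)) *
      (f ((η.remove q.1).add q.2) - f η)) +
    ∑' i : B, ((1 - ρ i) * (η i : ℝ) * (f (η.remove i) - f η) +
      ρ i * ((N : ℝ) - (η i : ℝ)) * (f (η.add i) - f η))

end Primal

/-! ## The dual process with absorbing sinks -/

section Dual

variable {S : Type*} {B : Set S} {N : ℕ}

/-- Finite dual configurations: finitely many particles on `S` and on the sink sites, with at most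
`N` particles on each site of `S` and any number on each sink. The set of sinks is a disjoint copy
of `B`: the sink of `i ∈ B` is `Sum.inr i`, and the sites of `S` are the `Sum.inl i`. -/
def DualConfig (B : Set S) (N : ℕ) : Type _ :=
  {ξ : (S ⊕ B) →₀ ℕ // ∀ i : S, ξ (Sum.inl i) ≤ N}

/-- The state space of the dual process is discrete. -/
instance : TopologicalSpace (DualConfig B N) := ⊥

instance : MeasurableSpace (DualConfig B N) := ⊤

/-- Number of particles of `ξ` at the site `i`. -/
def DualConfig.site (ξ : DualConfig B N) (i : S) : ℕ := ξ.1 (Sum.inl i)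

/-- Number of particles of `ξ` at the sink of the boundary site `i`. -/
def DualConfig.sink (ξ : DualConfig B N) (i : B) : ℕ := ξ.1 (Sum.inr i)

open Classical in
/-- Remove a particle at the site `i` (no effect if `i` is empty). -/
def DualConfig.remove (ξ : DualConfig B N) (i : S) : DualConfig B N :=
  ⟨ξ.1.update (Sum.inl i) (ξ.1 (Sum.inl i) - 1), fun k => by
    have hk := ξ.2 k
    have hi := ξ.2 i
    rw [Finsupp.update_apply]
    split_ifs <;> omega⟩

open Classical in
/-- Add a particle at the site `i` (no effect if `i` already holds `N` particles). -/
def DualConfig.add (ξ : DualConfig B N) (i : S) : DualConfig B N :=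
  ⟨ξ.1.update (Sum.inl i) (min (ξ.1 (Sum.inl i) + 1) N), fun k => by
    have hk := ξ.2 k
    rw [Finsupp.update_apply]
    split_ifs <;> omega⟩

open Classical in
/-- Add a particle at the sink of the boundary site `i`. -/
def DualConfig.addSink (ξ : DualConfig B N) (i : B) : DualConfig B N :=
  ⟨ξ.1.update (Sum.inr i) (ξ.1 (Sum.inr i) + 1), fun k => by
    have hk := ξ.2 k
    rw [Finsupp.update_apply]
    simpa using hk⟩

/-- Bounded functions on the dual state space. -/
def boundedFunctions (B : Set S) (N : ℕ) : Set (DualConfig B N → ℝ) :=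
  {f | ∃ C : ℝ, ∀ ξ, |f ξ| ≤ C}

/-- The generator of the dual process: `N`-SEP on `S`, and each particle at a boundary site jumps
at rate one to the sink of that site, where it stays for ever. For a bounded function both series
converge absolutely. -/
def dualGenerator (p : S → S → ℝ) (f : DualConfig B N → ℝ) (ξ : DualConfig B N) : ℝ :=
  (∑' q : S × S, p q.1 q.2 * (ξ.site q.1 : ℝ) * ((N : ℝ) - (ξ.site q.2 : ℝ)) *
      (f ((ξ.remove q.1).add q.2) - f ξ)) +
    ∑' i : B, (ξ.site i : ℝ) * (f ((ξ.remove i).addSink i) - f ξ)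

/-- The duality function; all but finitely many factors of both products are `1`. -/
def dualityFunction (ρ : B → ℝ) (η : Config S N) (ξ : DualConfig B N) : ℝ :=
  (∏ᶠ i : B, ρ i ^ ξ.sink i) *
    ∏ᶠ i : S, (Nat.choose (η i : ℕ) (ξ.site i) : ℝ) / (Nat.choose N (ξ.site i) : ℝ)

end Dual

end BoundarySEP

end

/-!
The duality rests on two facts.

*Duality of the generators.* With `a` primal and `m` dual particles at a site, the site contributes
`siteWeight N a m` to the duality function. The three recursions `mul_siteWeight_pred`,
`sub_mul_siteWeight_left_succ` and `sub_mul_siteWeight_right_succ` say that raising or lowering `a`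
amounts to an operation on `m`. Combined over the two ends of a bond, and symmetrized over its
orientation (this is where `p i l = p l i` enters), they give `siteWeight_exchange`; at a boundary
site they give `siteWeight_reservoir`, where the factor `ρ i` produced by the reservoir is the
weight of a particle in the sink. Summing over bonds and boundary sites,
`generator p B ρ (D · ξ) η = dualGenerator p (D η ·) ξ` (`generator_dualityFunction`).

*From generators to processes.* No Markov property or uniqueness for the martingale problems is
needed. Fix the starting points `x`, `y`, let `u r ξ` be the expectation of `D (Z r) ξ` under
`P x`, and let `G s r` be the expectation of `u r (W s)` under `Q y`. The desired identity is
`G t 0 = G 0 t`. Both processes satisfy Dynkin's formula, and by duality of the generators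
`∂ᵣ u r = dualGenerator p (u r)`, so that `∂ₛ G` and `∂ᵣ G` are both the expectation of
`dualGenerator p (u r) (W s)` and `G` is constant on antidiagonals. To make this rigorous
it is enough to bound `G (s + δ) r - G s (r + δ)` by a constant times `δ ^ 2`
(`eq_of_antidiagonal_increments`).

The dual generator is unbounded, since the total jump rate grows with the number `n` of particles.
That number is conserved, however, and on functions supported on the configurations with `n`
particles (`IsLevelFunction`) the dual generator has norm at most `2 * (N + 1) * n`. Hence
all functions of the dual configuration are cut off to the level `n = y.total` (`levelMean`), which
`W` almost surely never leaves (`ae_total_eq`).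
-/

open MeasureTheory Filter Topology
open scoped NNReal

noncomputable section

namespace BoundarySEP

/-! ### The single-site weights -/

/-- The factor `binom(a, m) / binom(N, m)` which a site with `a` particles of the primal process
and `m` particles of the dual process contributes to the duality function. -/
def siteWeight (N a m : ℕ) : ℝ := (a.choose m : ℝ) / (N.choose m : ℝ)

lemma cast_choose_succ_mul (n k : ℕ) :
    (n.choose (k + 1) : ℝ) * (k + 1) = n.choose k * ((n : ℝ) - k) := by
  rcases le_or_gt k n with h | h
  · have := Nat.choose_succ_right_eq n k
    have h2 : ((n.choose (k + 1) * (k + 1) : ℕ) : ℝ) = ((n.choose k * (n - k) : ℕ) : ℝ) := by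
      rw [this]
    push_cast [Nat.cast_sub h] at h2
    exact h2
  · simp [Nat.choose_eq_zero_of_lt h, Nat.choose_eq_zero_of_lt (h.trans (Nat.lt_succ_self k))]

/-- For `a = 0`, where `a - 1` is truncated, both sides vanish. -/
lemma mul_siteWeight_pred (N a m : ℕ) :
    (a : ℝ) * siteWeight N (a - 1) m = ((a : ℝ) - m) * siteWeight N a m := by
  unfold siteWeight
  rcases a with _ | a
  · rcases m with _ | m <;> simp
  · have h : ((a : ℝ) + 1) * a.choose m = ((a : ℝ) + 1 - m) * (a + 1).choose m := by
      rcases le_or_gt m (a + 1) with h | h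
      · have h2 := congrArg (Nat.cast (R := ℝ)) (Nat.choose_mul_succ_eq a m)
        push_cast [Nat.cast_sub h] at h2
        linarith
      · simp [Nat.choose_eq_zero_of_lt h, Nat.choose_eq_zero_of_lt ((Nat.lt_succ_self a).trans h)]
    simp only [Nat.add_sub_cancel, Nat.cast_add, Nat.cast_one]
    rw [mul_div_assoc', h, mul_div_assoc]

/-- The minimum is that in `DualConfig.add`; for `m = N` it takes effect, and both sides vanish. -/
lemma sub_mul_siteWeight_right_succ {N a m : ℕ} (ha : a ≤ N) (hm : m ≤ N) :
    ((N : ℝ) - m) * siteWeight N a (min (m + 1) N) = ((a : ℝ) - m) * siteWeight N a m := by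
  unfold siteWeight
  rcases hm.eq_or_lt with rfl | hm
  · rcases ha.eq_or_lt with rfl | ha
    · simp
    · simp [Nat.choose_eq_zero_of_lt ha]
  · have h1 := cast_choose_succ_mul a m
    have h2 := cast_choose_succ_mul N m
    have h3 : (0 : ℝ) < N.choose m := by exact_mod_cast Nat.choose_pos hm.le
    have h4 : (0 : ℝ) < N.choose (m + 1) := by exact_mod_cast Nat.choose_pos hm
    have h5 : (0 : ℝ) < m + 1 := by positivity
    rw [min_eq_left (by omega : m + 1 ≤ N), mul_div_assoc', mul_div_assoc',
      div_eq_div_iff h4.ne' h3.ne']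
    apply mul_right_cancel₀ h5.ne'
    linear_combination ((N : ℝ) - m) * N.choose m * h1 - ((a : ℝ) - m) * a.choose m * h2

/-- The minimum is that in `Config.add`; for `a = N` it takes effect, and both sides vanish. -/
lemma sub_mul_siteWeight_left_succ {N a m : ℕ} (ha : a ≤ N) (hm : m ≤ N) :
    ((N : ℝ) - a) * siteWeight N (min (a + 1) N) m =
      ((N : ℝ) - a - m) * siteWeight N a m + m * siteWeight N a (m - 1) := by
  unfold siteWeight
  rcases ha.eq_or_lt with rfl | ha
  · have h1 : (a.choose m : ℝ) ≠ 0 := by exact_mod_cast (Nat.choose_pos hm).ne'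
    have h2 : (a.choose (m - 1) : ℝ) ≠ 0 := by
      exact_mod_cast (Nat.choose_pos ((Nat.sub_le m 1).trans hm)).ne'
    simp [div_self h1, div_self h2]
  · rcases m with _ | k
    · simp
    · have h1 := cast_choose_succ_mul a k
      have h2 := cast_choose_succ_mul N k
      have h3 : (0 : ℝ) < N.choose k := by exact_mod_cast Nat.choose_pos (by omega : k ≤ N)
      have h4 : (0 : ℝ) < N.choose (k + 1) := by exact_mod_cast Nat.choose_pos hm
      rw [min_eq_left (by omega : a + 1 ≤ N), Nat.choose_succ_succ]
      simp only [Nat.add_sub_cancel, Nat.succ_eq_add_one]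
      push_cast
      field_simp
      linear_combination ((N.choose k : ℝ)) * h1 - (a.choose k : ℝ) * h2

lemma siteWeight_nonneg (N a m : ℕ) : 0 ≤ siteWeight N a m := by
  unfold siteWeight; positivity

lemma siteWeight_le_one {N a m : ℕ} (ha : a ≤ N) : siteWeight N a m ≤ 1 :=
  div_le_one_of_le₀ (by exact_mod_cast Nat.choose_le_choose m ha) (by positivity)

@[simp] lemma siteWeight_zero (N a : ℕ) : siteWeight N a 0 = 1 := by simp [siteWeight]

/-- The duality relation for the exchange of particles between two sites. It follows from the three
single-site relations, which express that `siteWeight` intertwines two representations of `su(2)`;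
all other terms cancel. -/
lemma siteWeight_exchange {N a b m n : ℕ} (ha : a ≤ N) (hb : b ≤ N) (hm : m ≤ N) (hn : n ≤ N) :
    (a : ℝ) * ((N : ℝ) - b) * (siteWeight N (a - 1) m * siteWeight N (min (b + 1) N) n -
        siteWeight N a m * siteWeight N b n) +
      (b : ℝ) * ((N : ℝ) - a) * (siteWeight N (min (a + 1) N) m * siteWeight N (b - 1) n -
        siteWeight N a m * siteWeight N b n) =
    (m : ℝ) * ((N : ℝ) - n) * (siteWeight N a (m - 1) * siteWeight N b (min (n + 1) N) -
        siteWeight N a m * siteWeight N b n) +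
      (n : ℝ) * ((N : ℝ) - m) * (siteWeight N a (min (m + 1) N) * siteWeight N b (n - 1) -
        siteWeight N a m * siteWeight N b n) := by
  have a1 := mul_siteWeight_pred N a m
  have b1 := mul_siteWeight_pred N b n
  have a2 := sub_mul_siteWeight_left_succ ha hm
  have b2 := sub_mul_siteWeight_left_succ hb hn
  have a3 := sub_mul_siteWeight_right_succ ha hm
  have b3 := sub_mul_siteWeight_right_succ hb hn
  linear_combination ((N : ℝ) - b) * siteWeight N (min (b + 1) N) n * a1 +
    ((a : ℝ) - m) * siteWeight N a m * b2 +
    ((N : ℝ) - a) * siteWeight N (min (a + 1) N) m * b1 +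
    ((b : ℝ) - n) * siteWeight N b n * a2 -
    m * siteWeight N a (m - 1) * b3 - n * siteWeight N b (n - 1) * a3

/-- The duality relation for a reservoir of density `r`: the dual particle is absorbed by the sink,
which contributes the factor `r`. -/
lemma siteWeight_reservoir {N a m : ℕ} (r : ℝ) (ha : a ≤ N) (hm : m ≤ N) :
    (1 - r) * a * (siteWeight N (a - 1) m - siteWeight N a m) +
      r * ((N : ℝ) - a) * (siteWeight N (min (a + 1) N) m - siteWeight N a m) =
    m * (r * siteWeight N a (m - 1) - siteWeight N a m) := by
  linear_combination (1 - r) * mul_siteWeight_pred N a m + r * sub_mul_siteWeight_left_succ ha hm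

/-! ### The duality function as a product over sites -/

section Algebra

variable {S : Type*} {B : Set S} {N : ℕ}

lemma finprod_update {ι : Type*} [DecidableEq ι] {g : ι → ℝ} (hg : g.mulSupport.Finite)
    (i : ι) (a : ℝ) :
    ∏ᶠ k, Function.update g i a k = a * ∏ᶠ k, Function.update g i 1 k := by
  have key : ∀ c : ℝ, ∏ᶠ k, Function.update g i c k =
      c * ∏ k ∈ insert i hg.toFinset \ {i}, g k := by
    intro c
    rw [finprod_eq_prod_of_mulSupport_subset (s := insert i hg.toFinset),
      Finset.prod_update_of_mem (Finset.mem_insert_self _ _)]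
    intro k hk
    by_cases h : k = i
    · simp [h]
    · have : g k ≠ 1 := by simpa [Function.update_of_ne h] using hk
      simp [this]
  rw [key a, key 1, one_mul]

lemma mulSupport_update_finite {ι : Type*} [DecidableEq ι] {g : ι → ℝ} (hg : g.mulSupport.Finite)
    (i : ι) (a : ℝ) :
    (Function.update g i a).mulSupport.Finite := by
  refine (hg.insert i).subset fun k hk => ?_
  by_cases h : k = i
  · simp [h]
  · exact Set.mem_insert_of_mem _ (by simpa [Function.update_of_ne h] using hk)

/-- The site factors of the duality function. -/
def siteFactor (η : Config S N) (ξ : DualConfig B N) (k : S) : ℝ := siteWeight N (η k) (ξ.site k)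

/-- The sink factors of the duality function. -/
def sinkFactor (ρ : B → ℝ) (ξ : DualConfig B N) (i : B) : ℝ := ρ i ^ ξ.sink i

lemma dualityFunction_eq (ρ : B → ℝ) (η : Config S N) (ξ : DualConfig B N) :
    dualityFunction ρ η ξ = (∏ᶠ i, sinkFactor ρ ξ i) * ∏ᶠ k, siteFactor η ξ k := rfl

lemma finite_site_ne_zero (ξ : DualConfig B N) : {k : S | ξ.site k ≠ 0}.Finite :=
  Set.Finite.preimage Sum.inl_injective.injOn ξ.1.hasFiniteSupport

lemma finite_sink_ne_zero (ξ : DualConfig B N) : {k : B | ξ.sink k ≠ 0}.Finite :=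
  Set.Finite.preimage Sum.inr_injective.injOn ξ.1.hasFiniteSupport

lemma mulSupport_siteFactor_subset (η : Config S N) (ξ : DualConfig B N) :
    (siteFactor η ξ).mulSupport ⊆ {k : S | ξ.site k ≠ 0} := by
  intro k hk h
  exact hk (by simp [siteFactor, h])

lemma mulSupport_siteFactor_finite (η : Config S N) (ξ : DualConfig B N) :
    (siteFactor η ξ).mulSupport.Finite :=
  (finite_site_ne_zero ξ).subset (mulSupport_siteFactor_subset η ξ)

lemma mulSupport_sinkFactor_finite (ρ : B → ℝ) (ξ : DualConfig B N) :
    (sinkFactor ρ ξ).mulSupport.Finite := by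
  refine (finite_sink_ne_zero ξ).subset fun k hk h => ?_
  exact hk (by simp [sinkFactor, show ξ.sink k = 0 from h])

lemma Config.le (η : Config S N) (i : S) : (η i : ℕ) ≤ N := by omega

lemma DualConfig.site_le (ξ : DualConfig B N) (i : S) : ξ.site i ≤ N := ξ.2 i

open Classical in
lemma siteFactor_config_add (η : Config S N) (ξ : DualConfig B N) (i : S) :
    siteFactor (η.add i) ξ = Function.update (siteFactor η ξ) i
      (siteWeight N (min ((η i : ℕ) + 1) N) (ξ.site i)) := by
  funext k
  by_cases h : k = i
  · subst h; simp [siteFactor, Config.add]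
  · simp [siteFactor, Config.add, h]

open Classical in
lemma siteFactor_config_remove (η : Config S N) (ξ : DualConfig B N) (i : S) :
    siteFactor (η.remove i) ξ = Function.update (siteFactor η ξ) i
      (siteWeight N ((η i : ℕ) - 1) (ξ.site i)) := by
  funext k
  by_cases h : k = i
  · subst h; simp [siteFactor, Config.remove]
  · simp [siteFactor, Config.remove, h]

open Classical in
lemma DualConfig.site_add (ξ : DualConfig B N) (i k : S) :
    (ξ.add i).site k = if k = i then min (ξ.site i + 1) N else ξ.site k := by
  simp [DualConfig.site, DualConfig.add, Finsupp.update_apply]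

open Classical in
lemma DualConfig.site_remove (ξ : DualConfig B N) (i k : S) :
    (ξ.remove i).site k = if k = i then ξ.site i - 1 else ξ.site k := by
  simp [DualConfig.site, DualConfig.remove, Finsupp.update_apply]

@[simp] lemma DualConfig.site_addSink (ξ : DualConfig B N) (i : B) (k : S) :
    (ξ.addSink i).site k = ξ.site k := by
  classical simp [DualConfig.site, DualConfig.addSink, Finsupp.update_apply]

@[simp] lemma DualConfig.sink_add (ξ : DualConfig B N) (i : S) (k : B) :
    (ξ.add i).sink k = ξ.sink k := by
  classical simp [DualConfig.sink, DualConfig.add, Finsupp.update_apply]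

@[simp] lemma DualConfig.sink_remove (ξ : DualConfig B N) (i : S) (k : B) :
    (ξ.remove i).sink k = ξ.sink k := by
  classical simp [DualConfig.sink, DualConfig.remove, Finsupp.update_apply]

open Classical in
lemma DualConfig.sink_addSink (ξ : DualConfig B N) (i k : B) :
    (ξ.addSink i).sink k = if k = i then ξ.sink i + 1 else ξ.sink k := by
  simp [DualConfig.sink, DualConfig.addSink, Finsupp.update_apply]

open Classical in
lemma siteFactor_dual_add (η : Config S N) (ξ : DualConfig B N) (i : S) :
    siteFactor η (ξ.add i) = Function.update (siteFactor η ξ) i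
      (siteWeight N (η i) (min (ξ.site i + 1) N)) := by
  funext k
  by_cases h : k = i
  · subst h; simp [siteFactor, DualConfig.site_add]
  · simp [siteFactor, DualConfig.site_add, h]

open Classical in
lemma siteFactor_dual_remove (η : Config S N) (ξ : DualConfig B N) (i : S) :
    siteFactor η (ξ.remove i) = Function.update (siteFactor η ξ) i
      (siteWeight N (η i) (ξ.site i - 1)) := by
  funext k
  by_cases h : k = i
  · subst h; simp [siteFactor, DualConfig.site_remove]
  · simp [siteFactor, DualConfig.site_remove, h]

lemma siteFactor_addSink (η : Config S N) (ξ : DualConfig B N) (i : B) :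
    siteFactor η (ξ.addSink i) = siteFactor η ξ := by
  funext k; simp [siteFactor]

lemma sinkFactor_add (ρ : B → ℝ) (ξ : DualConfig B N) (i : S) :
    sinkFactor ρ (ξ.add i) = sinkFactor ρ ξ := by
  funext k; simp [sinkFactor]

lemma sinkFactor_remove (ρ : B → ℝ) (ξ : DualConfig B N) (i : S) :
    sinkFactor ρ (ξ.remove i) = sinkFactor ρ ξ := by
  funext k; simp [sinkFactor]

lemma finprod_sinkFactor_addSink (ρ : B → ℝ) (ξ : DualConfig B N) (i : B) :
    ∏ᶠ k, sinkFactor ρ (ξ.addSink i) k = ρ i * ∏ᶠ k, sinkFactor ρ ξ k := by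
  classical
  have h : sinkFactor ρ (ξ.addSink i) =
      Function.update (sinkFactor ρ ξ) i (ρ i * sinkFactor ρ ξ i) := by
    funext k
    by_cases h : k = i
    · subst h; simp [sinkFactor, DualConfig.sink_addSink, pow_succ']
    · simp [sinkFactor, DualConfig.sink_addSink, h]
  have self := finprod_update (mulSupport_sinkFactor_finite ρ ξ) i (sinkFactor ρ ξ i)
  rw [Function.update_eq_self] at self
  rw [h, finprod_update (mulSupport_sinkFactor_finite ρ ξ), self, mul_assoc]

/-! ### Duality of the generators, term by term -/

lemma Config.add_remove_self {η : Config S N} {i : S} (h : (η i : ℕ) ≠ 0) :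
    (η.remove i).add i = η := by
  classical
  funext k
  by_cases hk : k = i
  · subst hk
    ext
    have := η.le k
    simp [Config.add, Config.remove]
    omega
  · simp [Config.add, Config.remove, hk]

lemma DualConfig.add_remove_self {ξ : DualConfig B N} {i : S} (h : ξ.site i ≠ 0) :
    (ξ.remove i).add i = ξ := by
  classical
  have h2 := ξ.site_le i
  apply Subtype.ext
  ext k
  rcases k with k | k
  · change ((ξ.remove i).add i).site k = ξ.site k
    by_cases hk : k = i
    · subst hk; simp [DualConfig.site_add, DualConfig.site_remove]; omega
    · simp [DualConfig.site_add, DualConfig.site_remove, hk]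
  · change ((ξ.remove i).add i).sink k = ξ.sink k
    simp

lemma dualityFunction_exchange (ρ : B → ℝ) (η : Config S N) (ξ : DualConfig B N) (i l : S) :
    (η i : ℝ) * ((N : ℝ) - (η l : ℝ)) *
        (dualityFunction ρ ((η.remove i).add l) ξ - dualityFunction ρ η ξ) +
      (η l : ℝ) * ((N : ℝ) - (η i : ℝ)) *
        (dualityFunction ρ ((η.remove l).add i) ξ - dualityFunction ρ η ξ) =
    (ξ.site i : ℝ) * ((N : ℝ) - (ξ.site l : ℝ)) *
        (dualityFunction ρ η ((ξ.remove i).add l) - dualityFunction ρ η ξ) +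
      (ξ.site l : ℝ) * ((N : ℝ) - (ξ.site i : ℝ)) *
        (dualityFunction ρ η ((ξ.remove l).add i) - dualityFunction ρ η ξ) := by
  classical
  by_cases hil : i = l
  · subst hil
    -- a jump from `i` to `i` does nothing unless `i` is empty, and then its rate is zero
    have h1 : (η i : ℝ) * (dualityFunction ρ ((η.remove i).add i) ξ - dualityFunction ρ η ξ)
        = 0 := by
      by_cases h : (η i : ℕ) = 0
      · simp [h]
      · simp [Config.add_remove_self h]
    have h2 : (ξ.site i : ℝ) * (dualityFunction ρ η ((ξ.remove i).add i) - dualityFunction ρ η ξ)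
        = 0 := by
      by_cases h : ξ.site i = 0
      · simp [h]
      · simp [DualConfig.add_remove_self h]
    linear_combination 2 * ((N : ℝ) - (η i : ℝ)) * h1 - 2 * ((N : ℝ) - (ξ.site i : ℝ)) * h2
  · have hli : l ≠ i := Ne.symm hil
    have hg := mulSupport_siteFactor_finite η ξ
    -- the product over all sites, with the factors at `i` and `l` split off
    have split : ∀ a b : ℝ, ∏ᶠ k, Function.update (Function.update (siteFactor η ξ) i a) l b k =
        a * b * ∏ᶠ k, Function.update (Function.update (siteFactor η ξ) l 1) i 1 k := by
      intro a b
      rw [finprod_update (mulSupport_update_finite hg i a),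
        Function.update_comm hil, finprod_update (mulSupport_update_finite hg l 1)]
      ring
    have self : ∏ᶠ k, siteFactor η ξ k = siteWeight N (η i) (ξ.site i) *
        siteWeight N (η l) (ξ.site l) *
        ∏ᶠ k, Function.update (Function.update (siteFactor η ξ) l 1) i 1 k := by
      rw [← split]
      congr 1
      funext k
      by_cases h1 : k = l
      · subst h1; simp [siteFactor]
      · by_cases h2 : k = i
        · subst h2; simp [siteFactor, hil]
        · simp [h1, h2]
    have e1 : ∀ (i' l' : S), i' ≠ l' → siteFactor ((η.remove i').add l') ξ =
        Function.update (Function.update (siteFactor η ξ) i'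
          (siteWeight N ((η i' : ℕ) - 1) (ξ.site i'))) l'
          (siteWeight N (min ((η l' : ℕ) + 1) N) (ξ.site l')) := by
      intro i' l' h
      rw [siteFactor_config_add, siteFactor_config_remove]
      simp [Config.remove, h.symm]
    have e2 : ∀ (i' l' : S), i' ≠ l' → siteFactor η ((ξ.remove i').add l') =
        Function.update (Function.update (siteFactor η ξ) i'
          (siteWeight N (η i') (ξ.site i' - 1))) l'
          (siteWeight N (η l') (min (ξ.site l' + 1) N)) := by
      intro i' l' h
      rw [siteFactor_dual_add, siteFactor_dual_remove]
      simp [DualConfig.site_remove, h.symm]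
    have key := siteWeight_exchange (η.le i) (η.le l) (ξ.site_le i) (ξ.site_le l)
    simp only [dualityFunction_eq, sinkFactor_add, sinkFactor_remove, e1 i l hil, e2 i l hil,
      e1 l i hli, e2 l i hli]
    rw [Function.update_comm hli, Function.update_comm hli, split, split, split, split, self]
    linear_combination ((∏ᶠ k, sinkFactor ρ ξ k) *
      ∏ᶠ k, Function.update (Function.update (siteFactor η ξ) l 1) i 1 k) * key

lemma dualityFunction_reservoir (ρ : B → ℝ) (η : Config S N) (ξ : DualConfig B N) (i : B) :
    (1 - ρ i) * (η i : ℝ) * (dualityFunction ρ (η.remove i) ξ - dualityFunction ρ η ξ) +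
      ρ i * ((N : ℝ) - (η i : ℝ)) * (dualityFunction ρ (η.add i) ξ - dualityFunction ρ η ξ) =
    (ξ.site i : ℝ) *
      (dualityFunction ρ η ((ξ.remove i).addSink i) - dualityFunction ρ η ξ) := by
  classical
  have hg := mulSupport_siteFactor_finite η ξ
  have split := finprod_update hg (i : S)
  have self : ∏ᶠ k, siteFactor η ξ k = siteWeight N (η i) (ξ.site i) *
      ∏ᶠ k, Function.update (siteFactor η ξ) i 1 k := by
    rw [← split, ← Function.update_eq_self (i : S) (siteFactor η ξ), Function.update_idem]
    rfl
  have key := siteWeight_reservoir (ρ i) (η.le i) (ξ.site_le i)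
  simp only [dualityFunction_eq, finprod_sinkFactor_addSink, sinkFactor_remove,
    siteFactor_addSink, siteFactor_config_add, siteFactor_config_remove, siteFactor_dual_remove]
  rw [split (siteWeight N ((η i : ℕ) - 1) _), split (siteWeight N (min _ N) _),
    split (siteWeight N (η i) (ξ.site i - 1)), self]
  linear_combination ((∏ᶠ k, sinkFactor ρ ξ k) *
      ∏ᶠ k, Function.update (siteFactor η ξ) i 1 k) * key

lemma dualityFunction_nonneg {ρ : B → ℝ} (hρ : ∀ i, 0 < ρ i ∧ ρ i < 1) (η : Config S N)
    (ξ : DualConfig B N) : 0 ≤ dualityFunction ρ η ξ :=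
  mul_nonneg (finprod_nonneg fun i => pow_nonneg (hρ i).1.le _)
    (finprod_nonneg fun _ => siteWeight_nonneg _ _ _)

lemma finprod_le_one {ι : Type*} {g : ι → ℝ} (hg : g.mulSupport.Finite) (h0 : ∀ i, 0 ≤ g i)
    (h1 : ∀ i, g i ≤ 1) : ∏ᶠ i, g i ≤ 1 := by
  rw [finprod_eq_prod_of_mulSupport_subset (s := hg.toFinset) g (by simp)]
  exact Finset.prod_le_one (fun i _ => h0 i) fun i _ => h1 i

lemma dualityFunction_le_one {ρ : B → ℝ} (hρ : ∀ i, 0 < ρ i ∧ ρ i < 1) (η : Config S N)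
    (ξ : DualConfig B N) : dualityFunction ρ η ξ ≤ 1 := by
  rw [dualityFunction_eq]
  refine mul_le_one₀ (finprod_le_one (mulSupport_sinkFactor_finite ρ ξ)
      (fun i => pow_nonneg (hρ i).1.le _) fun i => pow_le_one₀ (hρ i).1.le (hρ i).2.le)
    (finprod_nonneg fun _ => siteWeight_nonneg _ _ _)
    (finprod_le_one (mulSupport_siteFactor_finite η ξ) (fun _ => siteWeight_nonneg _ _ _)
      fun k => siteWeight_le_one (η.le k))

lemma abs_dualityFunction_le_one {ρ : B → ℝ} (hρ : ∀ i, 0 < ρ i ∧ ρ i < 1) (η : Config S N)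
    (ξ : DualConfig B N) : |dualityFunction ρ η ξ| ≤ 1 := by
  rw [abs_of_nonneg (dualityFunction_nonneg hρ η ξ)]
  exact dualityFunction_le_one hρ η ξ

/-- The duality function sees `η` only at the finitely many sites occupied by `ξ`. -/
lemma dualityFunction_congr (ρ : B → ℝ) {η η' : Config S N} {ξ : DualConfig B N}
    (h : ∀ i, ξ.site i ≠ 0 → η i = η' i) : dualityFunction ρ η ξ = dualityFunction ρ η' ξ := by
  have : siteFactor η ξ = siteFactor η' ξ := by
    funext k
    by_cases hk : ξ.site k = 0
    · simp [siteFactor, hk]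
    · simp [siteFactor, h k hk]
  rw [dualityFunction_eq, dualityFunction_eq, this]

lemma dualityFunction_mem_localFunctions (ρ : B → ℝ) (ξ : DualConfig B N) :
    (fun η => dualityFunction ρ η ξ) ∈ localFunctions S N :=
  ⟨(finite_site_ne_zero ξ).toFinset, fun η η' h =>
    dualityFunction_congr ρ fun i hi => h i (by simpa using hi)⟩

lemma measurable_dualityFunction (ρ : B → ℝ) (ξ : DualConfig B N) :
    Measurable fun η : Config S N => dualityFunction ρ η ξ := by
  have h : ∀ η : Config S N, dualityFunction ρ η ξ = (∏ᶠ i, sinkFactor ρ ξ i) *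
      ∏ k ∈ (finite_site_ne_zero ξ).toFinset, siteWeight N (η k) (ξ.site k) := by
    intro η
    rw [dualityFunction_eq, finprod_eq_prod_of_mulSupport_subset (siteFactor η ξ)
      (s := (finite_site_ne_zero ξ).toFinset)]
    · rfl
    · simpa using mulSupport_siteFactor_subset η ξ
  simp only [h]
  refine measurable_const.mul (Finset.measurable_fun_prod _ fun k _ => ?_)
  exact (measurable_of_countable (fun a : Fin (N + 1) => siteWeight N a (ξ.site k))).comp
    (measurable_pi_apply k)

end Algebra

/-! ### The dual generator on a level set of the particle number -/

section DualGenerator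

variable {S : Type*} {B : Set S} {N : ℕ}

/-- The total number of particles, on sites and sinks, of a dual configuration. -/
def DualConfig.total (ξ : DualConfig B N) : ℕ := ξ.1.degree

lemma degree_update {ι : Type*} (f : ι →₀ ℕ) (a : ι) (b : ℕ) :
    (f.update a b).degree + f a = f.degree + b := by
  have h1 := congrArg Finsupp.degree (Finsupp.update_eq_erase_add_single f a b)
  have h2 := congrArg Finsupp.degree (Finsupp.erase_add_single a f)
  rw [map_add, Finsupp.degree_single] at h1 h2
  omega

lemma DualConfig.total_remove {ξ : DualConfig B N} {i : S} (h : ξ.site i ≠ 0) :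
    (ξ.remove i).total + 1 = ξ.total := by
  classical
  have h1 := degree_update ξ.1 (Sum.inl i) (ξ.1 (Sum.inl i) - 1)
  have h2 : (ξ.remove i).total = (ξ.1.update (Sum.inl i) (ξ.1 (Sum.inl i) - 1)).degree := by
    simp only [DualConfig.total, DualConfig.remove]
  have h3 : ξ.1 (Sum.inl i) ≠ 0 := h
  unfold DualConfig.total at *
  omega

lemma DualConfig.total_add {ξ : DualConfig B N} {i : S} (h : ξ.site i < N) :
    (ξ.add i).total = ξ.total + 1 := by
  classical
  have h1 := degree_update ξ.1 (Sum.inl i) (min (ξ.1 (Sum.inl i) + 1) N)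
  have h2 : (ξ.add i).total = (ξ.1.update (Sum.inl i) (min (ξ.1 (Sum.inl i) + 1) N)).degree := by
    simp only [DualConfig.total, DualConfig.add]
  have h3 : ξ.1 (Sum.inl i) < N := h
  unfold DualConfig.total at *
  omega

lemma DualConfig.total_addSink (ξ : DualConfig B N) (i : B) :
    (ξ.addSink i).total = ξ.total + 1 := by
  classical
  have h1 := degree_update ξ.1 (Sum.inr i) (ξ.1 (Sum.inr i) + 1)
  have h2 : (ξ.addSink i).total = (ξ.1.update (Sum.inr i) (ξ.1 (Sum.inr i) + 1)).degree := by
    simp only [DualConfig.total, DualConfig.addSink]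
  unfold DualConfig.total at *
  omega

lemma DualConfig.total_exchange {ξ : DualConfig B N} {i l : S} (h : ξ.site i ≠ 0)
    (h' : ξ.site l ≠ N) : ((ξ.remove i).add l).total = ξ.total := by
  classical
  have hl := ξ.site_le l
  rw [DualConfig.total_add, DualConfig.total_remove h]
  by_cases hli : l = i
  · subst hli
    rw [DualConfig.site_remove, if_pos rfl]
    omega
  · rw [DualConfig.site_remove, if_neg hli]
    omega

lemma DualConfig.total_absorb {ξ : DualConfig B N} {i : B} (h : ξ.site i ≠ 0) :
    ((ξ.remove i).addSink i).total = ξ.total := by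
  rw [DualConfig.total_addSink, DualConfig.total_remove h]

/-- The rate at which the dual process moves a particle along the bond `q`. -/
def exchangeRate (p : S → S → ℝ) (ξ : DualConfig B N) (q : S × S) : ℝ :=
  p q.1 q.2 * (ξ.site q.1 : ℝ) * ((N : ℝ) - (ξ.site q.2 : ℝ))

lemma dualGenerator_eq (p : S → S → ℝ) (f : DualConfig B N → ℝ) (ξ : DualConfig B N) :
    dualGenerator p f ξ = (∑' q, exchangeRate p ξ q * (f ((ξ.remove q.1).add q.2) - f ξ)) +
      ∑' i : B, (ξ.site i : ℝ) * (f ((ξ.remove i).addSink i) - f ξ) := rfl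

lemma summable_comp_and_tsum_le {ι κ : Type*} (f : ι →₀ ℕ) {e : κ → ι}
    (he : Function.Injective e) :
    Summable (fun k => (f (e k) : ℝ)) ∧ ∑' k, (f (e k) : ℝ) ≤ f.degree := by
  classical
  have hz : ∀ k ∉ f.support.preimage e he.injOn, (f (e k) : ℝ) = 0 := by
    intro k hk
    simpa using hk
  refine ⟨summable_of_ne_finset_zero hz, ?_⟩
  rw [tsum_eq_sum hz, Finsupp.degree_apply]
  push_cast
  rw [← Finset.sum_image (f := fun x => (f x : ℝ)) (g := e) he.injOn]
  refine Finset.sum_le_sum_of_subset_of_nonneg ?_ fun _ _ _ => by positivity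
  intro x hx
  obtain ⟨k, hk, rfl⟩ := Finset.mem_image.1 hx
  simpa using hk

lemma summable_site (ξ : DualConfig B N) : Summable fun i : S => (ξ.site i : ℝ) :=
  (summable_comp_and_tsum_le ξ.1 Sum.inl_injective).1

lemma summable_boundary_site (ξ : DualConfig B N) : Summable fun i : B => (ξ.site i : ℝ) :=
  (summable_comp_and_tsum_le ξ.1 (e := fun i : B => Sum.inl (i : S))
    (Sum.inl_injective.comp Subtype.val_injective)).1

lemma tsum_site_le (ξ : DualConfig B N) : ∑' i : S, (ξ.site i : ℝ) ≤ ξ.total :=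
  (summable_comp_and_tsum_le ξ.1 Sum.inl_injective).2

lemma tsum_boundary_site_le (ξ : DualConfig B N) : ∑' i : B, (ξ.site i : ℝ) ≤ ξ.total :=
  (summable_comp_and_tsum_le ξ.1 (e := fun i : B => Sum.inl (i : S))
    (Sum.inl_injective.comp Subtype.val_injective)).2

variable {p : S → S → ℝ}

lemma summable_kernel_row_mul (hp : IsSymmetricKernel p) (i : S) (c : ℝ) :
    Summable fun l => p i l * c :=
  (hp.hasSum_one i).summable.mul_right c

lemma tsum_kernel_row_mul (hp : IsSymmetricKernel p) (i : S) (c : ℝ) :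
    ∑' l, p i l * c = c := by
  rw [tsum_mul_right, (hp.hasSum_one i).tsum_eq, one_mul]

lemma summable_kernel_mul_site (hp : IsSymmetricKernel p) (ξ : DualConfig B N) :
    Summable fun q : S × S => p q.1 q.2 * (ξ.site q.1 : ℝ) := by
  have h1 : ∀ i, Summable fun l => p i l * (ξ.site i : ℝ) :=
    fun i => summable_kernel_row_mul hp i _
  have h2 : Summable fun i => ∑' l, p i l * (ξ.site i : ℝ) := by
    rw [funext fun i => tsum_kernel_row_mul hp i (ξ.site i : ℝ)]
    exact summable_site ξ
  have h0 : ∀ q : S × S, 0 ≤ p q.1 q.2 * (ξ.site q.1 : ℝ) := fun q =>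
    mul_nonneg (hp.nonneg q.1 q.2) (Nat.cast_nonneg (ξ.site q.1))
  exact (summable_prod_of_nonneg h0).2 ⟨h1, h2⟩

lemma tsum_kernel_mul_site_le (hp : IsSymmetricKernel p) (ξ : DualConfig B N) :
    ∑' q : S × S, p q.1 q.2 * (ξ.site q.1 : ℝ) ≤ ξ.total := by
  have h := (summable_kernel_mul_site hp ξ).tsum_prod'
    fun i => summable_kernel_row_mul hp i (ξ.site i : ℝ)
  simp only [tsum_kernel_row_mul hp] at h
  rw [h]
  exact tsum_site_le ξ

lemma exchangeRate_nonneg (hp : IsSymmetricKernel p) (ξ : DualConfig B N) (q : S × S) :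
    0 ≤ exchangeRate p ξ q := by
  have h : (ξ.site q.2 : ℝ) ≤ N := by exact_mod_cast ξ.site_le q.2
  unfold exchangeRate
  exact mul_nonneg (mul_nonneg (hp.nonneg _ _) (Nat.cast_nonneg _)) (sub_nonneg.2 h)

lemma exchangeRate_le (hp : IsSymmetricKernel p) (ξ : DualConfig B N) (q : S × S) :
    exchangeRate p ξ q ≤ p q.1 q.2 * (ξ.site q.1 : ℝ) * N := by
  unfold exchangeRate
  exact mul_le_mul_of_nonneg_left (sub_le_self _ (Nat.cast_nonneg _))
    (mul_nonneg (hp.nonneg _ _) (Nat.cast_nonneg _))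

lemma summable_exchangeRate (hp : IsSymmetricKernel p) (ξ : DualConfig B N) :
    Summable (exchangeRate p ξ) :=
  .of_nonneg_of_le (exchangeRate_nonneg hp ξ) (exchangeRate_le hp ξ)
    ((summable_kernel_mul_site hp ξ).mul_right _)

lemma tsum_exchangeRate_le (hp : IsSymmetricKernel p) (ξ : DualConfig B N) :
    ∑' q, exchangeRate p ξ q ≤ ξ.total * N := by
  refine ((summable_exchangeRate hp ξ).tsum_le_tsum (exchangeRate_le hp ξ)
    ((summable_kernel_mul_site hp ξ).mul_right _)).trans ?_
  rw [tsum_mul_right]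
  exact mul_le_mul_of_nonneg_right (tsum_kernel_mul_site_le hp ξ) (Nat.cast_nonneg _)

lemma abs_mul_sub_le {c x y M : ℝ} (hc : 0 ≤ c) (hx : |x| ≤ M) (hy : |y| ≤ M) :
    |c * (x - y)| ≤ c * (2 * M) := by
  rw [abs_mul, abs_of_nonneg hc]
  refine mul_le_mul_of_nonneg_left ((abs_sub x y).trans ?_) hc
  linarith

lemma summable_exchange_terms (hp : IsSymmetricKernel p) {f : DualConfig B N → ℝ} {M : ℝ}
    (hf : ∀ ξ, |f ξ| ≤ M) (ξ : DualConfig B N) :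
    Summable fun q : S × S => exchangeRate p ξ q * (f ((ξ.remove q.1).add q.2) - f ξ) :=
  .of_norm_bounded ((summable_exchangeRate hp ξ).mul_right (2 * M))
    fun q => abs_mul_sub_le (exchangeRate_nonneg hp ξ q) (hf _) (hf _)

lemma summable_absorption_terms {f : DualConfig B N → ℝ} {M : ℝ}
    (hf : ∀ ξ, |f ξ| ≤ M) (ξ : DualConfig B N) :
    Summable fun i : B => (ξ.site i : ℝ) * (f ((ξ.remove i).addSink i) - f ξ) :=
  .of_norm_bounded ((summable_boundary_site ξ).mul_right (2 * M))
    fun i => abs_mul_sub_le (Nat.cast_nonneg (ξ.site i)) (hf _) (hf _)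

lemma abs_dualGenerator_le (hp : IsSymmetricKernel p) {f : DualConfig B N → ℝ} {M : ℝ}
    (hf : ∀ ξ, |f ξ| ≤ M) (ξ : DualConfig B N) :
    |dualGenerator p f ξ| ≤ 2 * (N + 1) * ξ.total * M := by
  have hM : 0 ≤ M := (abs_nonneg _).trans (hf ξ)
  have h1 := tsum_of_norm_bounded ((summable_exchangeRate hp ξ).mul_right (2 * M)).hasSum
    (f := fun q => exchangeRate p ξ q * (f ((ξ.remove q.1).add q.2) - f ξ))
    fun q => abs_mul_sub_le (exchangeRate_nonneg hp ξ q) (hf ((ξ.remove q.1).add q.2)) (hf ξ)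
  have h2 := tsum_of_norm_bounded ((summable_boundary_site ξ).mul_right (2 * M)).hasSum
    (f := fun i : B => (ξ.site i : ℝ) * (f ((ξ.remove i).addSink i) - f ξ))
    fun i => abs_mul_sub_le (Nat.cast_nonneg (ξ.site i)) (hf ((ξ.remove i).addSink i)) (hf ξ)
  rw [tsum_mul_right, Real.norm_eq_abs] at h1 h2
  have h3 := mul_le_mul_of_nonneg_right (tsum_exchangeRate_le hp ξ) (by positivity : 0 ≤ 2 * M)
  have h4 := mul_le_mul_of_nonneg_right (tsum_boundary_site_le ξ) (by positivity : 0 ≤ 2 * M)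
  rw [dualGenerator_eq]
  refine (abs_add_le _ _).trans ?_
  linarith

lemma dualGenerator_sub (hp : IsSymmetricKernel p) {f g : DualConfig B N → ℝ} {M M' : ℝ}
    (hf : ∀ ξ, |f ξ| ≤ M) (hg : ∀ ξ, |g ξ| ≤ M') (ξ : DualConfig B N) :
    dualGenerator p (fun ξ => f ξ - g ξ) ξ = dualGenerator p f ξ - dualGenerator p g ξ := by
  simp only [dualGenerator_eq]
  rw [add_sub_add_comm, ← (summable_exchange_terms hp hf ξ).tsum_sub
    (summable_exchange_terms hp hg ξ), ← (summable_absorption_terms hf ξ).tsum_sub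
    (summable_absorption_terms hg ξ)]
  congr 1 <;> refine tsum_congr fun q => ?_ <;> ring

/-- The dual dynamics conserves the number of particles, so the dual generator acts on each of its
level sets separately. -/
lemma dualGenerator_congr {f g : DualConfig B N → ℝ} {ξ : DualConfig B N}
    (h : ∀ ξ', ξ'.total = ξ.total → f ξ' = g ξ') :
    dualGenerator p f ξ = dualGenerator p g ξ := by
  simp only [dualGenerator_eq]
  congr 1 <;> refine tsum_congr fun q => ?_
  · by_cases h1 : ξ.site q.1 = 0
    · simp [exchangeRate, h1]
    by_cases h2 : ξ.site q.2 = N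
    · simp [exchangeRate, h2]
    rw [h _ (DualConfig.total_exchange h1 h2), h ξ rfl]
  · by_cases h1 : ξ.site q = 0
    · simp [h1]
    rw [h _ (DualConfig.total_absorb h1), h ξ rfl]

lemma dualGenerator_const (c : ℝ) (ξ : DualConfig B N) : dualGenerator p (fun _ => c) ξ = 0 := by
  simp [dualGenerator_eq]

/-- `f` is bounded by `M` and vanishes off the configurations with `n` particles. On such functions
the dual generator is a bounded operator. -/
structure IsLevelFunction (n : ℕ) (M : ℝ) (f : DualConfig B N → ℝ) : Prop where
  abs_le : ∀ ξ, |f ξ| ≤ M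
  eq_zero : ∀ ξ, ξ.total ≠ n → f ξ = 0

lemma IsLevelFunction.dualGenerator (hp : IsSymmetricKernel p) {n : ℕ} {M : ℝ}
    {f : DualConfig B N → ℝ} (hf : IsLevelFunction n M f) :
    IsLevelFunction n (2 * (N + 1) * n * M) (dualGenerator p f) := by
  have h0 : ∀ ξ, ξ.total ≠ n → BoundarySEP.dualGenerator p f ξ = 0 := by
    intro ξ hξ
    rw [dualGenerator_congr (g := fun _ => 0) fun ξ' h => hf.eq_zero ξ' (h ▸ hξ),
      dualGenerator_const]
  refine ⟨fun ξ => ?_, h0⟩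
  by_cases hξ : ξ.total = n
  · simpa [hξ] using abs_dualGenerator_le hp hf.abs_le ξ
  · have : 0 ≤ M := (abs_nonneg _).trans (hf.abs_le ξ)
    rw [h0 ξ hξ, abs_zero]
    positivity

/-- Integration over a parameter commutes with the dual generator. -/
lemma dualGenerator_integral [Countable S] (hp : IsSymmetricKernel p) {X : Type*}
    {m : MeasurableSpace X} {μ : Measure X} [IsProbabilityMeasure μ] {F : X → DualConfig B N → ℝ}
    {M : ℝ} (hF : ∀ ξ, Measurable fun ω => F ω ξ) (hM : ∀ ω ξ, |F ω ξ| ≤ M)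
    (ξ : DualConfig B N) :
    dualGenerator p (fun ξ => ∫ ω, F ω ξ ∂μ) ξ = ∫ ω, dualGenerator p (F ω) ξ ∂μ := by
  have hint : ∀ ξ, Integrable (fun ω => F ω ξ) μ := fun ξ =>
    .of_bound (hF ξ).aestronglyMeasurable M (ae_of_all _ fun ω => hM ω ξ)
  have key : ∀ {ι : Type _} [Countable ι] (c : ι → ℝ) (ζ : ι → DualConfig B N), (∀ i, 0 ≤ c i) →
      Summable c → Integrable (fun ω => ∑' i, c i * (F ω (ζ i) - F ω ξ)) μ ∧
        ∑' i, c i * (∫ ω, F ω (ζ i) ∂μ - ∫ ω, F ω ξ ∂μ) =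
          ∫ ω, ∑' i, c i * (F ω (ζ i) - F ω ξ) ∂μ := by
    intro ι _ c ζ hc hs
    have h1 : ∀ i, Integrable (fun ω => c i * (F ω (ζ i) - F ω ξ)) μ := fun i =>
      ((hint _).sub (hint _)).const_mul _
    have h2 : ∀ i ω, ‖c i * (F ω (ζ i) - F ω ξ)‖ ≤ c i * (2 * M) := fun i ω =>
      abs_mul_sub_le (hc i) (hM _ _) (hM _ _)
    have h3 : Summable fun i => ∫ ω, ‖c i * (F ω (ζ i) - F ω ξ)‖ ∂μ := by
      refine .of_nonneg_of_le (fun i => integral_nonneg fun ω => norm_nonneg _) (fun i => ?_)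
        (hs.mul_right (2 * M))
      simpa using integral_mono (h1 i).norm (integrable_const _) (h2 i)
    refine ⟨?_, ?_⟩
    · refine .of_bound (Measurable.aestronglyMeasurable ?_) (∑' i, c i * (2 * M))
        (ae_of_all _ fun ω => tsum_of_norm_bounded (hs.mul_right (2 * M)).hasSum fun i => h2 i ω)
      refine measurable_of_tendsto_metrizable' (atTop : Filter (Finset ι))
        (f := fun s ω => ∑ i ∈ s, c i * (F ω (ζ i) - F ω ξ))
        (fun s => Finset.measurable_fun_sum _ fun i _ =>
          (((hF _).sub (hF _)).const_mul _)) (tendsto_pi_nhds.2 fun ω => ?_)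
      exact (Summable.of_norm_bounded (hs.mul_right (2 * M)) fun i => h2 i ω).hasSum
    · rw [← (hasSum_integral_of_summable_integral_norm h1 h3).tsum_eq]
      refine tsum_congr fun i => ?_
      rw [integral_const_mul, integral_sub (hint _) (hint _)]
  have k1 := key (exchangeRate p ξ) (fun q => (ξ.remove q.1).add q.2)
    (exchangeRate_nonneg hp ξ) (summable_exchangeRate hp ξ)
  have k2 := key (fun i : B => (ξ.site i : ℝ)) (fun i : B => (ξ.remove i).addSink i)
    (fun i => Nat.cast_nonneg _) (summable_boundary_site ξ)
  simp only [dualGenerator_eq]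
  rw [integral_add k1.1 k2.1, k1.2, k2.2]

lemma measurable_dualGenerator [Countable S] (hp : IsSymmetricKernel p) {X : Type*}
    {m : MeasurableSpace X} {F : X → DualConfig B N → ℝ}
    {M : ℝ} (hF : ∀ ξ, Measurable fun ω => F ω ξ) (hM : ∀ ω ξ, |F ω ξ| ≤ M)
    (ξ : DualConfig B N) : Measurable fun ω => dualGenerator p (F ω) ξ := by
  simp only [dualGenerator_eq]
  refine Measurable.add ?_ ?_
  · refine measurable_of_tendsto_metrizable' (atTop : Filter (Finset (S × S)))
      (f := fun s ω => ∑ q ∈ s, exchangeRate p ξ q * (F ω ((ξ.remove q.1).add q.2) - F ω ξ))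
      (fun s => Finset.measurable_fun_sum _ fun q _ =>
        (((hF _).sub (hF _)).const_mul _)) (tendsto_pi_nhds.2 fun ω => ?_)
    exact (summable_exchange_terms hp (hM ω) ξ).hasSum
  · refine measurable_of_tendsto_metrizable' (atTop : Filter (Finset B))
      (f := fun (s : Finset B) ω => ∑ i ∈ s, (ξ.site i : ℝ) * (F ω ((ξ.remove i).addSink i) - F ω ξ))
      (fun s => Finset.measurable_fun_sum _ fun q _ =>
        (((hF _).sub (hF _)).const_mul _)) (tendsto_pi_nhds.2 fun ω => ?_)
    exact (summable_absorption_terms (hM ω) ξ).hasSum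

/-- Duality of the generators. The exchange terms agree only after symmetrization over the two
orientations of a bond. -/
theorem generator_dualityFunction (hp : IsSymmetricKernel p) {ρ : B → ℝ}
    (hρ : ∀ i, 0 < ρ i ∧ ρ i < 1) (η : Config S N) (ξ : DualConfig B N) :
    generator p B ρ (fun η => dualityFunction ρ η ξ) η =
      dualGenerator p (dualityFunction ρ η) ξ := by
  have tsum_symm : ∀ a : S × S → ℝ, Summable a → 2 * ∑' q, a q = ∑' q, (a q + a q.swap) := by
    intro a ha
    have hswap : Summable fun q : S × S => a q.swap := ha.comp_injective Prod.swap_injective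
    have e : ∑' q : S × S, a q.swap = ∑' q, a q := (Equiv.prodComm S S).tsum_eq a
    rw [ha.tsum_add hswap, e]
    ring
  have hsum : Summable fun q : S × S => p q.1 q.2 * (η q.1 : ℝ) * ((N : ℝ) - (η q.2 : ℝ)) *
      (dualityFunction ρ ((η.remove q.1).add q.2) ξ - dualityFunction ρ η ξ) := by
    have s1 := (summable_kernel_mul_site hp ξ).mul_right ((N : ℝ) * N)
    have s2 := s1.comp_injective Prod.swap_injective
    refine .of_norm_bounded (s1.add s2) fun q => ?_
    have a1 : (η q.1 : ℝ) ≤ N := by exact_mod_cast η.le q.1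
    have a2 : (η q.2 : ℝ) ≤ N := by exact_mod_cast η.le q.2
    have b1 : (0 : ℝ) ≤ (η q.1 : ℝ) := Nat.cast_nonneg _
    have b2 : (0 : ℝ) ≤ (η q.2 : ℝ) := Nat.cast_nonneg _
    -- the difference vanishes unless the bond `q` meets an occupied site of `ξ`
    have hD : |dualityFunction ρ ((η.remove q.1).add q.2) ξ - dualityFunction ρ η ξ| ≤
        ξ.site q.1 + ξ.site q.2 := by
      by_cases h : ξ.site q.1 = 0 ∧ ξ.site q.2 = 0
      · have : dualityFunction ρ ((η.remove q.1).add q.2) ξ = dualityFunction ρ η ξ := by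
          classical
          refine dualityFunction_congr ρ fun i hi => ?_
          have h1 : i ≠ q.1 := fun e => hi (e ▸ h.1)
          have h2 : i ≠ q.2 := fun e => hi (e ▸ h.2)
          simp [Config.add, Config.remove, h1, h2]
        rw [this, sub_self, abs_zero]
        positivity
      · have h1 : (1 : ℝ) ≤ ξ.site q.1 + ξ.site q.2 := by
          have : 1 ≤ ξ.site q.1 + ξ.site q.2 := by omega
          exact_mod_cast this
        refine le_trans (abs_le.2 ⟨?_, ?_⟩) h1
        · linarith [dualityFunction_nonneg hρ ((η.remove q.1).add q.2) ξ,
            dualityFunction_le_one hρ η ξ]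
        · linarith [dualityFunction_nonneg hρ η ξ,
            dualityFunction_le_one hρ ((η.remove q.1).add q.2) ξ]
    have hrate : (η q.1 : ℝ) * ((N : ℝ) - (η q.2 : ℝ)) ≤ N * N :=
      mul_le_mul a1 (by linarith) (by linarith) (by positivity)
    have hrate0 : 0 ≤ (η q.1 : ℝ) * ((N : ℝ) - (η q.2 : ℝ)) := mul_nonneg b1 (by linarith)
    simp only [Function.comp_apply, Prod.fst_swap, Prod.snd_swap]
    rw [hp.symm q.2 q.1, mul_assoc (p q.1 q.2), Real.norm_eq_abs, abs_mul,
      abs_of_nonneg (mul_nonneg (hp.nonneg _ _) hrate0)]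
    calc p q.1 q.2 * ((η q.1 : ℝ) * ((N : ℝ) - (η q.2 : ℝ))) *
          |dualityFunction ρ ((η.remove q.1).add q.2) ξ - dualityFunction ρ η ξ|
        ≤ p q.1 q.2 * (N * N) * (ξ.site q.1 + ξ.site q.2) :=
          mul_le_mul (mul_le_mul_of_nonneg_left hrate (hp.nonneg _ _)) hD (abs_nonneg _)
            (mul_nonneg (hp.nonneg _ _) (by positivity))
      _ = _ := by ring
  have hsum' := summable_exchange_terms hp (abs_dualityFunction_le_one hρ η) ξ
  unfold generator
  rw [dualGenerator_eq]
  congr 1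
  · refine mul_left_cancel₀ (two_ne_zero (α := ℝ)) ?_
    rw [tsum_symm _ hsum, tsum_symm _ hsum']
    refine tsum_congr fun q => ?_
    have := dualityFunction_exchange ρ η ξ q.1 q.2
    simp only [exchangeRate, Prod.fst_swap, Prod.snd_swap, hp.symm q.2 q.1]
    linear_combination p q.1 q.2 * this
  · exact tsum_congr fun i => dualityFunction_reservoir ρ η ξ i

end DualGenerator

/-! ### Expectations of a solution of the martingale problem -/

section MartingaleProblem

variable {E X : Type*} [TopologicalSpace E] [MeasurableSpace E] {m : MeasurableSpace X}

/-- A process with right-continuous paths is jointly measurable in time and randomness. -/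
lemma measurable_uncurry_of_continuousWithinAt [TopologicalSpace.PseudoMetrizableSpace E]
    [BorelSpace E] {Z : ℝ≥0 → X → E} (hm : ∀ t, Measurable (Z t))
    (hr : ∀ ω t, ContinuousWithinAt (fun s => Z s ω) (Set.Ici t) t) :
    Measurable (Function.uncurry Z) := by
  -- discretize time from the right
  have hn : ∀ n : ℕ, (0 : ℝ≥0) < n + 1 := fun n => by positivity
  obtain ⟨σ, hσ⟩ : ∃ σ : ℕ → ℕ → ℝ≥0, ∀ n k, σ n k = ((k : ℝ≥0) + 1) / (n + 1) :=
    ⟨_, fun _ _ => rfl⟩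
  have hκ : ∀ n : ℕ, Measurable fun t : ℝ≥0 => ⌊t * (n + 1)⌋₊ := fun n =>
    (measurable_id.mul_const _).nat_floor
  have hle : ∀ (n : ℕ) (t : ℝ≥0), t ≤ σ n ⌊t * (n + 1)⌋₊ := fun n t => by
    rw [hσ, le_div_iff₀ (hn n)]
    exact (Nat.lt_floor_add_one _).le
  have hge : ∀ (n : ℕ) (t : ℝ≥0), σ n ⌊t * (n + 1)⌋₊ ≤ t + 1 / (n + 1) := fun n t => by
    rw [hσ, div_le_iff₀ (hn n), add_mul, div_mul_cancel₀ _ (hn n).ne']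
    gcongr
    exact Nat.floor_le zero_le
  have hlim : ∀ t : ℝ≥0, Tendsto (fun n : ℕ => σ n ⌊t * (n + 1)⌋₊) atTop (𝓝[≥] t) := fun t => by
    refine tendsto_nhdsWithin_iff.2 ⟨?_, .of_forall fun n => hle n t⟩
    refine tendsto_of_tendsto_of_tendsto_of_le_of_le tendsto_const_nhds ?_
      (fun n => hle n t) fun n => hge n t
    have h := (tendsto_const_nhds (x := t)).add
      (tendsto_one_div_add_atTop_nhds_zero_nat (𝕜 := ℝ≥0))
    rwa [add_zero] at h
  have hmeas : ∀ n : ℕ, Measurable fun x : ℝ≥0 × X => Z (σ n ⌊x.1 * (n + 1)⌋₊) x.2 := fun n => by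
    have h1 : Measurable fun y : ℕ × X => Z (σ n y.1) y.2 :=
      measurable_from_prod_countable_right fun k => hm (σ n k)
    generalize hf : (fun t : ℝ≥0 => ⌊t * (n + 1)⌋₊) = κ
    have hκn := hκ n
    rw [hf] at hκn
    have h2 : ∀ t : ℝ≥0, ⌊t * (n + 1)⌋₊ = κ t := fun t => by rw [← hf]
    simp only [h2]
    exact h1.comp ((hκn.comp measurable_fst).prodMk measurable_snd)
  exact measurable_of_tendsto_metrizable hmeas
    (tendsto_pi_nhds.2 fun x => (hr x.2 x.1).tendsto.comp (hlim x.1))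

variable {dom : Set (E → ℝ)} {L : (E → ℝ) → E → ℝ} {𝓕 : Filtration ℝ≥0 m}
  {P : E → Measure X} {Z : ℝ≥0 → X → E}

/-- The expectation of `f` at the time `t`, for the process started from `x`. Times are real numbers
here; negative ones count as `0`. -/
def expectation (P : E → Measure X) (Z : ℝ≥0 → X → E) (x : E) (f : E → ℝ) (t : ℝ) : ℝ :=
  ∫ ω, f (Z t.toNNReal ω) ∂(P x)

lemma IsProcessWithGenerator.measurable (h : IsProcessWithGenerator dom L 𝓕 P Z) (t : ℝ≥0) :
    Measurable (Z t) :=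
  (h.adapted t).mono (𝓕.le t) le_rfl

lemma IsProcessWithGenerator.integrable (h : IsProcessWithGenerator dom L 𝓕 P Z) (x : E)
    {f : E → ℝ} (hf : Measurable f) {C : ℝ} (hC : ∀ z, |f z| ≤ C) (t : ℝ≥0) :
    Integrable (fun ω => f (Z t ω)) (P x) :=
  have := h.isProbabilityMeasure x
  .of_bound (hf.comp (h.measurable t)).aestronglyMeasurable C (ae_of_all _ fun _ => hC _)

lemma IsProcessWithGenerator.abs_expectation_le (h : IsProcessWithGenerator dom L 𝓕 P Z) (x : E)
    {f : E → ℝ} {C : ℝ} (hC : ∀ z, |f z| ≤ C) (t : ℝ) : |expectation P Z x f t| ≤ C := by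
  have := h.isProbabilityMeasure x
  simpa [expectation] using norm_integral_le_of_norm_le_const (μ := P x)
    (f := fun ω => f (Z t.toNNReal ω)) (ae_of_all _ fun _ => hC _)

lemma IsProcessWithGenerator.expectation_zero (h : IsProcessWithGenerator dom L 𝓕 P Z) (x : E)
    (f : E → ℝ) : expectation P Z x f 0 = f x := by
  have := h.isProbabilityMeasure x
  have : (fun ω => f (Z (0 : ℝ).toNNReal ω)) =ᵐ[P x] fun _ => f x := by
    filter_upwards [h.initial x] with ω hω
    rw [Real.toNNReal_zero, hω]
  rw [expectation, integral_congr_ae this]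
  simp

variable [TopologicalSpace.PseudoMetrizableSpace E] [BorelSpace E]

lemma IsProcessWithGenerator.measurable_uncurry (h : IsProcessWithGenerator dom L 𝓕 P Z) :
    Measurable fun y : ℝ × X => Z y.1.toNNReal y.2 :=
  (measurable_uncurry_of_continuousWithinAt h.measurable h.right_continuous).comp
    ((measurable_real_toNNReal.comp measurable_fst).prodMk measurable_snd)

lemma IsProcessWithGenerator.intervalIntegrable_expectation
    (h : IsProcessWithGenerator dom L 𝓕 P Z) (x : E) {f : E → ℝ} (hf : Measurable f) {C : ℝ}
    (hC : ∀ z, |f z| ≤ C) (a b : ℝ) :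
    IntervalIntegrable (expectation P Z x f) volume a b := by
  have := h.isProbabilityMeasure x
  refine (intervalIntegrable_const (c := C)).mono_fun ?_ (ae_of_all _ fun t => ?_)
  · have := (hf.comp h.measurable_uncurry).stronglyMeasurable.integral_prod_right' (ν := P x)
    exact this.aestronglyMeasurable
  · exact (h.abs_expectation_le x hC t).trans (le_abs_self C)

/-- Dynkin's formula. -/
lemma IsProcessWithGenerator.expectation_eq (h : IsProcessWithGenerator dom L 𝓕 P Z) (x : E)
    {f : E → ℝ} (hfd : f ∈ dom) (hf : Measurable f) {C : ℝ} (hC : ∀ z, |f z| ≤ C)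
    (hg : Measurable (L f)) {C' : ℝ} (hC' : ∀ z, |L f z| ≤ C') {t : ℝ} (ht : 0 ≤ t) :
    expectation P Z x f t =
      expectation P Z x f 0 + ∫ s in (0 : ℝ)..t, expectation P Z x (L f) s := by
  have := h.isProbabilityMeasure x
  lift t to ℝ≥0 using ht
  have hM := h.martingale x f hfd
  have h0 := hM.setIntegral_eq (zero_le (a := t)) MeasurableSet.univ
  simp only [NNReal.coe_zero, intervalIntegral.integral_same, sub_self, integral_zero,
    setIntegral_univ] at h0
  have hfin : IsFiniteMeasure (volume.restrict (Set.uIoc 0 (t : ℝ))) := ⟨by simp [Set.uIoc]⟩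
  have hint : Integrable (Function.uncurry fun (s : ℝ) ω => L f (Z s.toNNReal ω))
      ((volume.restrict (Set.uIoc 0 (t : ℝ))).prod (P x)) := by
    refine .of_bound (hg.comp h.measurable_uncurry).aestronglyMeasurable C'
      (ae_of_all _ fun _ => hC' _)
  have hswap := intervalIntegral_integral_swap hint
  have i1 := h.integrable x hf hC t
  have i2 := h.integrable x hf hC 0
  have i3 : Integrable (fun ω => ∫ s in (0 : ℝ)..(t : ℝ), L f (Z s.toNNReal ω)) (P x) := by
    have h3 := (i1.sub i2).sub (hM.integrable t)
    refine h3.congr (ae_of_all _ fun ω => ?_)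
    simp
  have h4 := integral_sub (i1.sub i2) i3
  have h5 := integral_sub i1 i2
  simp only [Pi.sub_apply] at h4
  rw [h4, h5, ← hswap] at h0
  simp only [expectation, Real.toNNReal_coe, Real.toNNReal_zero]
  linarith

end MartingaleProblem

/-! ### Second-order increments -/

section Increments

variable {φ ψ : ℝ → ℝ} {C : ℝ}

lemma increment_eq (hψ : ∀ a b, IntervalIntegrable ψ volume a b)
    (hφ : ∀ t, 0 ≤ t → φ t = φ 0 + ∫ s in (0 : ℝ)..t, ψ s) {s δ : ℝ} (hs : 0 ≤ s) (hδ : 0 ≤ δ) :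
    φ (s + δ) - φ s = ∫ u in s..s + δ, ψ u := by
  rw [hφ (s + δ) (by positivity), hφ s hs,
    ← intervalIntegral.integral_interval_sub_left (hψ 0 (s + δ)) (hψ 0 s)]
  ring

lemma abs_increment_le (hψ : ∀ a b, IntervalIntegrable ψ volume a b)
    (hφ : ∀ t, 0 ≤ t → φ t = φ 0 + ∫ s in (0 : ℝ)..t, ψ s) (hC : ∀ t, |ψ t| ≤ C) {s δ : ℝ}
    (hs : 0 ≤ s) (hδ : 0 ≤ δ) : |φ (s + δ) - φ s| ≤ C * δ := by
  rw [increment_eq hψ hφ hs hδ]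
  have := intervalIntegral.norm_integral_le_of_norm_le_const (a := s) (b := s + δ) (f := ψ)
    fun t _ => hC t
  simpa [abs_of_nonneg hδ] using this

lemma abs_second_increment_le (hψ : ∀ a b, IntervalIntegrable ψ volume a b)
    (hφ : ∀ t, 0 ≤ t → φ t = φ 0 + ∫ s in (0 : ℝ)..t, ψ s)
    (hC : ∀ s δ, 0 ≤ s → 0 ≤ δ → |ψ (s + δ) - ψ s| ≤ C * δ) (hC0 : 0 ≤ C) {s δ : ℝ}
    (hs : 0 ≤ s) (hδ : 0 ≤ δ) : |φ (s + δ) - φ s - δ * ψ s| ≤ C * δ * δ := by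
  have h1 : φ (s + δ) - φ s - δ * ψ s = ∫ u in s..s + δ, (ψ u - ψ s) := by
    rw [increment_eq hψ hφ hs hδ, intervalIntegral.integral_sub (hψ _ _) intervalIntegrable_const]
    simp
  rw [h1]
  have := intervalIntegral.norm_integral_le_of_norm_le_const (a := s) (b := s + δ)
    (f := fun u => ψ u - ψ s) (C := C * δ) fun u hu => by
      rw [Set.uIoc_of_le (by linarith)] at hu
      have h := hC s (u - s) hs (by linarith [hu.1])
      rw [add_sub_cancel] at h
      exact h.trans (mul_le_mul_of_nonneg_left (by linarith [hu.2]) hC0)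
  simpa [abs_of_nonneg hδ] using this

/-- A function of two times whose increments along antidiagonals are of second order is constant on
antidiagonals. -/
lemma eq_of_antidiagonal_increments {G : ℝ → ℝ → ℝ} {K t : ℝ} (ht : 0 ≤ t)
    (hG : ∀ s r δ, 0 ≤ s → 0 ≤ r → 0 ≤ δ → |G (s + δ) r - G s (r + δ)| ≤ K * δ * δ) :
    G t 0 = G 0 t := by
  have key : ∀ n : ℕ, |G t 0 - G 0 t| ≤ K * t * t * (1 / ((n : ℝ) + 1)) := by
    intro n
    set δ : ℝ := t / (n + 1) with hδ
    have hδ0 : 0 ≤ δ := by positivity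
    have hn : ((n : ℝ) + 1) * δ = t := by rw [hδ]; field_simp
    have step : ∀ k : ℕ, k ≤ n + 1 →
        |G (k * δ) (t - k * δ) - G 0 t| ≤ k * (K * δ * δ) := by
      intro k
      induction k with
      | zero => intro _; simp
      | succ k ih =>
        intro hk
        have hk' : (k : ℝ) + 1 ≤ n + 1 := by exact_mod_cast hk
        have hr : 0 ≤ t - ((k : ℝ) + 1) * δ := by
          have := mul_le_mul_of_nonneg_right hk' hδ0
          linarith
        have h1 := hG (k * δ) (t - ((k : ℝ) + 1) * δ) δ (by positivity) hr hδ0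
        have h2 := ih (by omega)
        rw [show (k : ℝ) * δ + δ = ((k : ℝ) + 1) * δ by ring,
          show t - ((k : ℝ) + 1) * δ + δ = t - k * δ by ring] at h1
        push_cast
        have := (abs_sub_le _ _ _).trans (add_le_add h1 h2)
        linarith
    have := step (n + 1) le_rfl
    push_cast at this
    rw [hn, sub_self] at this
    refine this.trans (le_of_eq ?_)
    rw [hδ]
    field_simp
  have hlim : Tendsto (fun n : ℕ => K * t * t * (1 / ((n : ℝ) + 1))) atTop (𝓝 0) := by
    simpa using (tendsto_one_div_add_atTop_nhds_zero_nat (𝕜 := ℝ)).const_mul (K * t * t)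
  have h0 := ge_of_tendsto' hlim key
  exact sub_eq_zero.1 (abs_nonpos_iff.1 h0)

end Increments

/-! ### Duality of the processes -/

section Duality

variable {S : Type*} {B : Set S} {N : ℕ}

instance : DiscreteTopology (DualConfig B N) := ⟨rfl⟩

instance : DiscreteMeasurableSpace (DualConfig B N) := ⟨fun _ => trivial⟩

instance : BorelSpace (DualConfig B N) := ⟨by
  rw [borel_eq_top_of_discrete]; rfl⟩

variable {p : S → S → ℝ} {X Y : Type*} {mX : MeasurableSpace X} {mY : MeasurableSpace Y}

section DualProcess

variable {𝓖 : Filtration ℝ≥0 mY} {Q : DualConfig B N → Measure Y} {W : ℝ≥0 → Y → DualConfig B N}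

lemma IsLevelFunction.mem_boundedFunctions {n : ℕ} {M : ℝ} {f : DualConfig B N → ℝ}
    (hf : IsLevelFunction n M f) : f ∈ boundedFunctions B N :=
  ⟨M, hf.abs_le⟩

/-- The operator norm of the dual generator on functions of configurations with `n` particles is at
most `levelBound N n`. -/
def levelBound (N n : ℕ) : ℝ := 2 * (N + 1) * n

lemma levelBound_nonneg (N n : ℕ) : 0 ≤ levelBound N n := by unfold levelBound; positivity

lemma dual_expectation_eq (hp : IsSymmetricKernel p)
    (hW : IsProcessWithGenerator (boundedFunctions B N) (dualGenerator p) 𝓖 Q W) {n : ℕ} {M : ℝ}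
    {f : DualConfig B N → ℝ} (hf : IsLevelFunction n M f) (y : DualConfig B N) (t : ℝ)
    (ht : 0 ≤ t) :
    expectation Q W y f t =
      expectation Q W y f 0 + ∫ s in (0 : ℝ)..t, expectation Q W y (dualGenerator p f) s :=
  hW.expectation_eq y hf.mem_boundedFunctions .of_discrete hf.abs_le .of_discrete
    (hf.dualGenerator hp).abs_le ht

lemma dual_second_increment (hp : IsSymmetricKernel p)
    (hW : IsProcessWithGenerator (boundedFunctions B N) (dualGenerator p) 𝓖 Q W) {n : ℕ} {M : ℝ}
    {f : DualConfig B N → ℝ} (hf : IsLevelFunction n M f) (y : DualConfig B N) {s δ : ℝ}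
    (hs : 0 ≤ s) (hδ : 0 ≤ δ) :
    |expectation Q W y f (s + δ) - expectation Q W y f s -
        δ * expectation Q W y (dualGenerator p f) s| ≤
      levelBound N n * (levelBound N n * M) * δ * δ := by
  have hM : 0 ≤ M := (abs_nonneg _).trans (hf.abs_le y)
  have hf1 := hf.dualGenerator hp
  have hf2 := hf1.dualGenerator hp
  have hK := levelBound_nonneg N n
  refine abs_second_increment_le
    (hW.intervalIntegrable_expectation y .of_discrete hf1.abs_le)
    (dual_expectation_eq hp hW hf y) (fun s δ hs hδ => ?_) (by positivity) hs hδ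
  exact abs_increment_le (hW.intervalIntegrable_expectation y .of_discrete hf2.abs_le)
    (dual_expectation_eq hp hW hf1 y) (hW.abs_expectation_le y hf2.abs_le) hs hδ

/-- The number of dual particles is almost surely conserved. -/
lemma ae_total_eq
    (hW : IsProcessWithGenerator (boundedFunctions B N) (dualGenerator p) 𝓖 Q W)
    (y : DualConfig B N) (t : ℝ≥0) : ∀ᵐ ω ∂(Q y), (W t ω).total = y.total := by
  have := hW.isProbabilityMeasure y
  let f : DualConfig B N → ℝ := fun ξ => if ξ.total = y.total then 0 else 1
  have hC : ∀ ξ, |f ξ| ≤ 1 := fun ξ => by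
    by_cases h : ξ.total = y.total <;> simp [f, h]
  have hL : dualGenerator p f = fun _ => 0 := by
    funext ξ
    rw [dualGenerator_congr (g := fun _ => f ξ) fun ξ' h => by simp only [f, h],
      dualGenerator_const]
  have h := hW.expectation_eq y (f := f) ⟨1, hC⟩ .of_discrete hC .of_discrete (C' := 0)
    (by simp [hL]) t.2
  rw [hL, hW.expectation_zero] at h
  have h0 : ∫ ω, f (W t ω) ∂(Q y) = 0 := by
    simpa [expectation, f] using h
  have h1 := (integral_eq_zero_iff_of_nonneg (fun ω => by
    change (0 : ℝ) ≤ f (W t ω); simp only [f]; split_ifs <;> norm_num)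
    (hW.integrable y (f := f) .of_discrete hC t)).1 h0
  filter_upwards [h1] with ω hω
  by_contra hne
  simp [f, hne] at hω

end DualProcess

section PrimalProcess

variable {𝓕 : Filtration ℝ≥0 mX} {P : Config S N → Measure X}
  {Z : ℝ≥0 → X → Config S N} {ρ : B → ℝ}

/-- The expected duality function at the time `r`, as a function of the dual configuration, cut off
to the configurations with `n` particles. -/
def levelMean (P : Config S N → Measure X) (Z : ℝ≥0 → X → Config S N) (ρ : B → ℝ)
    (x : Config S N) (n : ℕ) (r : ℝ) (ξ : DualConfig B N) : ℝ :=
  if ξ.total = n then expectation P Z x (fun η => dualityFunction ρ η ξ) r else 0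

lemma isLevelFunction_levelMean (hρ : ∀ i, 0 < ρ i ∧ ρ i < 1)
    (hZ : IsProcessWithGenerator (localFunctions S N) (generator p B ρ) 𝓕 P Z)
    (x : Config S N) (n : ℕ) (r : ℝ) : IsLevelFunction n 1 (levelMean P Z ρ x n r) := by
  refine ⟨fun ξ => ?_, fun ξ h => by simp [levelMean, h]⟩
  unfold levelMean
  split_ifs
  · exact hZ.abs_expectation_le x (fun η => abs_dualityFunction_le_one hρ η ξ) r
  · simp

lemma generator_dualityFunction_fun (hp : IsSymmetricKernel p) (hρ : ∀ i, 0 < ρ i ∧ ρ i < 1)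
    (ξ : DualConfig B N) :
    generator p B ρ (fun η => dualityFunction ρ η ξ) =
      fun η => dualGenerator p (dualityFunction ρ η) ξ :=
  funext fun η => generator_dualityFunction hp hρ η ξ

/-- The backward equation: by duality of the generators, the dual generator drives the expected
duality function of the primal process. -/
lemma expectation_generator_dualityFunction [Countable S] (hp : IsSymmetricKernel p)
    (hρ : ∀ i, 0 < ρ i ∧ ρ i < 1)
    (hZ : IsProcessWithGenerator (localFunctions S N) (generator p B ρ) 𝓕 P Z)
    (x : Config S N) (ξ : DualConfig B N) (r : ℝ) :
    expectation P Z x (generator p B ρ fun η => dualityFunction ρ η ξ) r =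
      dualGenerator p (levelMean P Z ρ x ξ.total r) ξ := by
  have := hZ.isProbabilityMeasure x
  rw [dualGenerator_congr (g := fun ξ' => expectation P Z x (fun η => dualityFunction ρ η ξ') r)
    fun ξ' h => by simp [levelMean, h]]
  rw [generator_dualityFunction_fun hp hρ]
  exact (dualGenerator_integral hp (μ := P x)
    (F := fun ω ξ' => dualityFunction ρ (Z r.toNNReal ω) ξ')
    (fun ξ' => (measurable_dualityFunction ρ ξ').comp (hZ.measurable _))
    (fun ω ξ' => abs_dualityFunction_le_one hρ _ _) ξ).symm

lemma abs_generator_dualityFunction_le (hp : IsSymmetricKernel p) (hρ : ∀ i, 0 < ρ i ∧ ρ i < 1)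
    (ξ : DualConfig B N) (η : Config S N) :
    |generator p B ρ (fun η => dualityFunction ρ η ξ) η| ≤ levelBound N ξ.total * 1 := by
  rw [generator_dualityFunction hp hρ]
  exact abs_dualGenerator_le hp (abs_dualityFunction_le_one hρ η) ξ

lemma measurable_generator_dualityFunction [Countable S] (hp : IsSymmetricKernel p)
    (hρ : ∀ i, 0 < ρ i ∧ ρ i < 1) (ξ : DualConfig B N) :
    Measurable (generator p B ρ fun η => dualityFunction ρ η ξ) := by
  rw [generator_dualityFunction_fun hp hρ]
  exact measurable_dualGenerator hp (F := fun η => dualityFunction ρ η)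
    (measurable_dualityFunction ρ) (abs_dualityFunction_le_one hρ) ξ

lemma primal_second_increment [Countable S] (hp : IsSymmetricKernel p)
    (hρ : ∀ i, 0 < ρ i ∧ ρ i < 1)
    (hZ : IsProcessWithGenerator (localFunctions S N) (generator p B ρ) 𝓕 P Z)
    (x : Config S N) (n : ℕ) (ξ : DualConfig B N) {r δ : ℝ} (hr : 0 ≤ r) (hδ : 0 ≤ δ) :
    |levelMean P Z ρ x n (r + δ) ξ - levelMean P Z ρ x n r ξ -
        δ * dualGenerator p (levelMean P Z ρ x n r) ξ| ≤
      levelBound N n * (levelBound N n * 1) * δ * δ := by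
  have hK := levelBound_nonneg N n
  have hU := isLevelFunction_levelMean hρ hZ x n
  have prim : ∀ ξ : DualConfig B N, ∀ t, 0 ≤ t →
      expectation P Z x (fun η => dualityFunction ρ η ξ) t =
        expectation P Z x (fun η => dualityFunction ρ η ξ) 0 + ∫ s in (0 : ℝ)..t,
          expectation P Z x (generator p B ρ fun η => dualityFunction ρ η ξ) s := fun ξ t ht =>
    hZ.expectation_eq x (dualityFunction_mem_localFunctions ρ ξ) (measurable_dualityFunction ρ ξ)
      (fun η => abs_dualityFunction_le_one hρ η ξ) (measurable_generator_dualityFunction hp hρ ξ)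
      (abs_generator_dualityFunction_le hp hρ ξ) ht
  have hint : ∀ ξ : DualConfig B N, ∀ a b, IntervalIntegrable
      (expectation P Z x (generator p B ρ fun η => dualityFunction ρ η ξ)) volume a b := fun ξ =>
    hZ.intervalIntegrable_expectation x (measurable_generator_dualityFunction hp hρ ξ)
      (abs_generator_dualityFunction_le hp hρ ξ)
  by_cases hξ : ξ.total = n
  · subst hξ
    have lip : ∀ s δ, 0 ≤ s → 0 ≤ δ → IsLevelFunction ξ.total (levelBound N ξ.total * 1 * δ)
        (fun ξ' => levelMean P Z ρ x ξ.total (s + δ) ξ' - levelMean P Z ρ x ξ.total s ξ') := by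
      refine fun s δ hs hδ => ⟨fun ξ' => ?_, fun ξ' h => by simp [levelMean, h]⟩
      by_cases h : ξ'.total = ξ.total
      · simp only [levelMean, h, if_true]
        refine abs_increment_le (hint ξ') (prim ξ') (fun t => ?_) hs hδ
        rw [← h]
        exact hZ.abs_expectation_le x (abs_generator_dualityFunction_le hp hρ ξ') t
      · simp only [levelMean, h, if_false, sub_self, abs_zero]
        positivity
    have hlip : ∀ s δ, 0 ≤ s → 0 ≤ δ →
        |expectation P Z x (generator p B ρ fun η => dualityFunction ρ η ξ) (s + δ) -
          expectation P Z x (generator p B ρ fun η => dualityFunction ρ η ξ) s| ≤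
        levelBound N ξ.total * (levelBound N ξ.total * 1) * δ := by
      intro s δ hs hδ
      rw [expectation_generator_dualityFunction hp hρ hZ,
        expectation_generator_dualityFunction hp hρ hZ,
        ← dualGenerator_sub hp (hU _).abs_le (hU _).abs_le, mul_assoc]
      exact ((lip s δ hs hδ).dualGenerator hp).abs_le ξ
    have := abs_second_increment_le (hint ξ) (prim ξ) hlip (by positivity) hr hδ
    rw [expectation_generator_dualityFunction hp hρ hZ] at this
    simpa only [levelMean, if_true] using this
  · rw [((hU r).dualGenerator hp).eq_zero ξ hξ, (hU r).eq_zero ξ hξ, (hU _).eq_zero ξ hξ]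
    simp only [sub_self, mul_zero, abs_zero]
    positivity

end PrimalProcess

/-- The Ethier–Kurtz duality argument: running the primal process for the time `r` and the dual
process for the time `s`, the mean of the duality function depends only on `s + r`. -/
theorem isDualWith_dualityFunction [Countable S] (hp : IsSymmetricKernel p) {ρ : B → ℝ}
    (hρ : ∀ i, 0 < ρ i ∧ ρ i < 1)
    {𝓕 : Filtration ℝ≥0 mX} {P : Config S N → Measure X} {Z : ℝ≥0 → X → Config S N}
    (hZ : IsProcessWithGenerator (localFunctions S N) (generator p B ρ) 𝓕 P Z)
    {𝓖 : Filtration ℝ≥0 mY} {Q : DualConfig B N → Measure Y} {W : ℝ≥0 → Y → DualConfig B N}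
    (hW : IsProcessWithGenerator (boundedFunctions B N) (dualGenerator p) 𝓖 Q W) :
    IsDualWith P Z Q W (dualityFunction ρ) := by
  intro t x y
  have := hW.isProbabilityMeasure y
  set n := y.total with hn
  have hU := isLevelFunction_levelMean hρ hZ x n
  -- `G s r` runs the primal process for the time `r` and the dual process for the time `s`
  let G : ℝ → ℝ → ℝ := fun s r => expectation Q W y (levelMean P Z ρ x n r) s
  have hint : ∀ {f : DualConfig B N → ℝ} {M : ℝ}, (∀ ξ, |f ξ| ≤ M) → ∀ s : ℝ,
      Integrable (fun ω => f (W s.toNNReal ω)) (Q y) :=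
    fun hf s => hW.integrable y .of_discrete hf _
  have hG : G t 0 = G 0 t := by
    refine eq_of_antidiagonal_increments (K := 2 * (levelBound N n * (levelBound N n * 1))) t.2
      fun s r δ hs hr hδ => ?_
    have h1 := dual_second_increment hp hW (hU r) y hs hδ
    have h2 := hW.abs_expectation_le y (fun ξ => primal_second_increment hp hρ hZ x n ξ hr hδ) s
    have i1 := hint (hU (r + δ)).abs_le s
    have i2 := hint (hU r).abs_le s
    have i3 := hint ((hU r).dualGenerator hp).abs_le s
    have h3 : expectation Q W y (fun ξ => levelMean P Z ρ x n (r + δ) ξ - levelMean P Z ρ x n r ξ -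
        δ * dualGenerator p (levelMean P Z ρ x n r) ξ) s =
        G s (r + δ) - G s r - δ * expectation Q W y (dualGenerator p (levelMean P Z ρ x n r)) s := by
      simp only [expectation, G]
      refine (integral_sub (i1.sub i2) (i3.const_mul δ)).trans ?_
      rw [integral_const_mul]
      congr 1
      exact integral_sub i1 i2
    rw [h3] at h2
    have h4 := (abs_sub _ _).trans (add_le_add h1 h2)
    refine le_trans (le_of_eq ?_) (h4.trans (le_of_eq ?_))
    · congr 1
      simp only [G]
      ring
    · ring
  have h0 : G 0 t = ∫ ω, dualityFunction ρ (Z t ω) y ∂(P x) := by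
    simp only [G, hW.expectation_zero, levelMean, hn, if_true]
    simp only [expectation, Real.toNNReal_coe]
  have h1 : G t 0 = ∫ ω, dualityFunction ρ x (W t ω) ∂(Q y) := by
    simp only [G, expectation, Real.toNNReal_coe]
    refine integral_congr_ae ?_
    filter_upwards [ae_total_eq hW y t] with ω hω
    simp only [levelMean, hω, ← hn, if_true, hZ.expectation_zero]
  rw [← h0, ← hG, h1]

end Duality

end BoundarySEP

end

theorem theorem4p4 {S : Type*} [Countable S] (N : ℕ) (p : S → S → ℝ)
    (hp : BoundarySEP.IsSymmetricKernel p) (B : Set S) (ρ : B → ℝ)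
    (hρ : ∀ i, 0 < ρ i ∧ ρ i < 1)
    {X Y : Type*} {mX : MeasurableSpace X} {mY : MeasurableSpace Y}
    (𝓕 : MeasureTheory.Filtration NNReal mX)
    (P : BoundarySEP.Config S N → MeasureTheory.Measure X)
    (Z : NNReal → X → BoundarySEP.Config S N)
    (hZ : BoundarySEP.IsProcessWithGenerator (BoundarySEP.localFunctions S N)
      (BoundarySEP.generator p B ρ) 𝓕 P Z)
    (𝓖 : MeasureTheory.Filtration NNReal mY)
    (Q : BoundarySEP.DualConfig B N → MeasureTheory.Measure Y)
    (W : NNReal → Y → BoundarySEP.DualConfig B N)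
    (hW : BoundarySEP.IsProcessWithGenerator (BoundarySEP.boundedFunctions B N)
      (BoundarySEP.dualGenerator p) 𝓖 Q W) :
    BoundarySEP.IsDualWith P Z Q W (BoundarySEP.dualityFunction ρ) := by
  exact BoundarySEP.isDualWith_dualityFunction hp hρ hZ hW
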